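/- Let $n\ge 0$ and $k\ge 1$ be integers. Alice has input bits $x_1,\dots,x_n$ and sends information to Bob as follows. For each $i$ she chooses uniformly at random $k$ bits $x_{i1},\dots,x_{ik}$ with $x_i=\sum_{j=1}^k x_{ij} \bmod 2$, independently for different $i$, and she chooses independent unbiased bits $s_1,\dots,s_k$, independent of the $x_{ij}$. For each pair $(i,j)$ she encodes $x_{ij}$ into two qubits: $0$ is encoded as $|00\rangle$ if $s_j=0$ and as $|{+}{+}\rangle$ if $s_j=1$; $1$ is encoded as $|10\rangle$ if $s_j=0$ and as $|{+}{-}\rangle$ if $s_j=1$. She teleports each of the $2kn$ qubits to Bob through an EPR pair $\frac{1}{\sqrt2}(|00\rangle+|11\rangle)$; for each pair $(i,j)$ she tells Bob the bit for the $X$ correction on the first qubit and the bit for the $Z$ correction on the second qubit, but not the bit for the $Z$ correction on the first qubit nor the bit for the $X$ correction on the second qubit. In the scheme (which computes a linear polynomial $c+\sum_i a_i x_i \bmod 2$ with coefficients known to Bob) this is the only communication from Alice to Bob. Suppose that Alice's input $(x_1,\dots,x_n)$ is uniformly distributed on $\{0,1\}^n$ in Bob's view. For a function $f$ of the input, let the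 information about $f(x)$ learnable by a cheating Bob be the maximum, over all measurements (POVMs with finitely many outcomes, joint over the $2kn$ qubits received and possibly depending on Alice's classical message), of the mutual information in bits between $f(x)$ and everything that the measurement yields. Then: (i) For every $i\in\{1,\dots,n\}$, the information learnable by a cheating Bob about the single bit $x_i$ is exactly $\frac{1}{2^k}$ bits. (ii) The information learnable by a cheating Bob about the whole input $(x_1,\dots,x_n)$ is at least $n-k$ bits. (In both cases the maximum is attained.) -/

import Mathlib

namespace QHE

open scoped BigOperators Kronecker ComplexOrder

noncomputable section

/-! Bits are elements of `ZMod 2`; a one-qubit vector is given by its amplitudes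
`ZMod 2 → ℂ` in the computational basis. -/

/-- The vectors `|0⟩`, `|1⟩`. -/
def ketZ (b : ZMod 2) : ZMod 2 → ℂ := fun y => if y = b then 1 else 0

/-- The vectors `|+⟩` (for `b = 0`) and `|-⟩` (for `b = 1`). -/
def ketX (b : ZMod 2) : ZMod 2 → ℂ := fun y =>
  (if b = 1 ∧ y = 1 then -1 else 1) / (Real.sqrt 2 : ℂ)

/-- The two qubits that encode a bit `x` with basis bit `s`:
`|x⟩|0⟩` if `s = 0` and `|+⟩|±⟩` (sign given by `x`) if `s = 1`. -/
def encode (x s : ZMod 2) (l : Fin 2) : ZMod 2 → ℂ :=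
  if s = 0 then (if l = 0 then ketZ x else ketZ 0)
  else (if l = 0 then ketX 0 else ketX x)

/-- The Bell vector `(Zᵇ ⊗ Xᵃ) (|00⟩ + |11⟩) / √2`; the EPR pair is `bell 0 0`. -/
def bell (a b : ZMod 2) (y z : ZMod 2) : ℂ :=
  (if z = y + a then (if b = 1 ∧ y = 1 then -1 else 1) else 0) / (Real.sqrt 2 : ℂ)

/-- Alice holds a qubit in state `ψ` and the first half of an EPR pair, Bob holds the other half.
Alice measures her two qubits in the Bell basis and obtains `o = (a, b)`.  This is the resulting
subnormalised vector of Bob's half (its squared norm is the probability of the outcome); it is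
`Xᵃ Zᵇ ψ / 2`, so `a` is the bit for the `X` correction and `b` the bit for the `Z` correction. -/
def teleport (ψ : ZMod 2 → ℂ) (o : ZMod 2 × ZMod 2) : ZMod 2 → ℂ := fun z =>
  ∑ y : ZMod 2, ∑ y' : ZMod 2, star (bell o.1 o.2 y y') * (ψ y * bell 0 0 y' z)

/-- Alice's input: `n` bits. -/
abbrev Input (n : ℕ) := Fin n → ZMod 2

/-- Labels of the `2kn` qubits: `(i, j, l)` is the `l`-th qubit of the pair `(i, j)`. -/
abbrev QubitLabel (n k : ℕ) := Fin n × Fin k × Fin 2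

/-- Computational basis of the `2kn` qubits that Bob receives. -/
abbrev Qubits (n k : ℕ) := QubitLabel n k → ZMod 2

/-- Alice's classical message: two bits for every pair `(i, j)`. -/
abbrev Message (n k : ℕ) := Fin n × Fin k → ZMod 2 × ZMod 2

/-- Basis of everything that Bob holds: the classical message and his qubits. -/
abbrev BobSpace (n k : ℕ) := Message n k × Qubits n k

/-- Possible results of all of Alice's Bell measurements. -/
abbrev BellOutcomes (n k : ℕ) := QubitLabel n k → ZMod 2 × ZMod 2

/-- The families of shares `x_{ij}` with `x_i = ∑_j x_{ij}` modulo 2. -/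
def shares (n k : ℕ) (x : Input n) : Finset (Fin n → Fin k → ZMod 2) :=
  Finset.univ.filter fun w => ∀ i, ∑ j, w i j = x i

/-- What Alice tells Bob: the `X` correction bit of the first qubit of each pair and the `Z`
correction bit of the second qubit.  The other two correction bits are withheld. -/
def message {n k : ℕ} (o : BellOutcomes n k) : Message n k := fun p =>
  ((o (p.1, p.2, 0)).1, (o (p.1, p.2, 1)).2)

/-- The subnormalised vector of Bob's qubits for given shares `w`, basis bits `s` and Bell
outcomes `o`. -/
def bobVector {n k : ℕ} (w : Fin n → Fin k → ZMod 2) (s : Fin k → ZMod 2)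
    (o : BellOutcomes n k) : Qubits n k → ℂ := fun q =>
  ∏ p : QubitLabel n k, teleport (encode (w p.1 p.2.1) (s p.2.1) p.2.2) (o p) (q p)

/-- The state of everything that Bob holds after Alice's message, when her input is `x`: the
average over her uniformly random shares of `x`, her uniformly random bits `s_j` (one for each `j`,
common to all `i`), and the results of her Bell measurements. -/
def bobState (n k : ℕ) (x : Input n) : Matrix (BobSpace n k) (BobSpace n k) ℂ :=
  (((shares n k x).card : ℂ)⁻¹ * ((2 : ℂ) ^ k)⁻¹) •
    ∑ w ∈ shares n k x, ∑ s : Fin k → ZMod 2, ∑ o : BellOutcomes n k,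
      Matrix.single (message o) (message o) (1 : ℂ) ⊗ₖ
        Matrix.vecMulVec (bobVector w s o) (star (bobVector w s o))

/-- A generalised measurement (POVM) with outcomes in `Y`. -/
structure POVM (ι Y : Type) [Fintype ι] [DecidableEq ι] [Fintype Y] where
  effect : Y → Matrix ι ι ℂ
  posSemidef : ∀ y, (effect y).PosSemidef
  sum_eq_one : ∑ y, effect y = 1

/-- Mutual information, in bits, of two random variables with joint distribution `p`
(with the convention `0 log 0 = 0`). -/
def mutualInfo {A Y : Type} [Fintype A] [Fintype Y] (p : A → Y → ℝ) : ℝ :=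
  ∑ a, ∑ y, p a y * Real.logb 2 (p a y / ((∑ y', p a y') * ∑ a', p a' y))

/-- The joint distribution of the function `f` of Alice's uniformly distributed input and of the
result of Bob's measurement `M` on everything that he holds. -/
def jointLaw {n k : ℕ} {A Y : Type} [DecidableEq A] [Fintype Y]
    (f : Input n → A) (M : POVM (BobSpace n k) Y) (a : A) (y : Y) : ℝ :=
  ∑ x : Input n, if f x = a then
    ((2 : ℝ) ^ n)⁻¹ * ((bobState n k x * M.effect y).trace).re else 0

/-- The amounts of information (in bits) about `f` of Alice's input that a cheating Bob obtains
with the various measurements, joint over all his qubits and depending on Alice's message. -/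
def obtainableInfo (n k : ℕ) {A : Type} [Fintype A] [DecidableEq A] (f : Input n → A) : Set ℝ :=
  {r | ∃ (m : ℕ) (M : POVM (BobSpace n k) (Fin m)), r = mutualInfo (jointLaw f M)}

/-- `r` is the information about `f` of Alice's input learnable by a cheating Bob: the maximum,
over all measurements, of the mutual information with the result. -/
def IsLearnableInfo (n k : ℕ) {A : Type} [Fintype A] [DecidableEq A] (f : Input n → A)
    (r : ℝ) : Prop :=
  IsGreatest (obtainableInfo n k f) r

end

end QHE

/-! A withheld `Z` bit dephases the first qubit of each pair in the computational basis, and a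
withheld `X` bit dephases the second in the Hadamard basis. Hence Bob's states for all inputs are
diagonal in one product basis (`bobState_eq`). By data processing (`mutualInfo_comp_le`), measuring
in that basis is optimal for every `f` (`isLearnableInfo_of_common_basis`), so only a classical
computation remains.

After correction by the announced bits, each pair yields two bits: the one selected by `s_j` is
`x_{ij}`, the other is pure noise. With `u_{ij}` the first bit and `d_{ij}` the sum of both, `x_{ij}
= u_{ij} + s_j d_{ij}`. Jointly, the observation `z` and `s` are independent and uniform, and `x =
inputGuess s z` (`bobLaw_eq`).

(i) Given `z`, `x_i = ∑_j u_{ij} + ∑_j s_j d_{ij}` is known if `d_i = 0` and unbiased otherwise;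
`d_i` is uniform on `2^k` vectors, so the information is `1 / 2^k`. (ii) Given `z`, the input
depends only on the `k` bits `s`, so at most `k` of its `n` bits of entropy remain. -/

namespace QHE

open scoped BigOperators Kronecker ComplexOrder

noncomputable section

/-! ### Data processing -/

/-- The log-sum inequality. -/
theorem logb_sum_inequality {C : Type} [Fintype C] (α β : C → ℝ) (hα : ∀ c, 0 ≤ α c)
    (hβ : ∀ c, 0 ≤ β c) (h0 : ∀ c, β c = 0 → α c = 0) :
    (∑ c, α c) * Real.logb 2 ((∑ c, α c) / ∑ c, β c)
      ≤ ∑ c, α c * Real.logb 2 (α c / β c) := by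
  have hlog2 : 0 < Real.log 2 := Real.log_pos one_lt_two
  rcases (Finset.sum_nonneg fun c (_ : c ∈ Finset.univ) => hα c).eq_or_lt with hA | hA
  · have hz : ∀ c, α c = 0 := fun c =>
      (Finset.sum_eq_zero_iff_of_nonneg fun c _ => hα c).1 hA.symm c (Finset.mem_univ c)
    simp [hz]
  have hB : 0 < ∑ c, β c := by
    refine (Finset.sum_nonneg fun c _ => hβ c).lt_of_ne fun h => hA.ne' ?_
    have hz : ∀ c, β c = 0 := fun c =>
      (Finset.sum_eq_zero_iff_of_nonneg fun c _ => hβ c).1 h.symm c (Finset.mem_univ c)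
    exact Finset.sum_eq_zero fun c _ => h0 c (hz c)
  set r := (∑ c, α c) / ∑ c, β c with hr
  have hr0 : 0 < r := div_pos hA hB
  -- The bound `1 - 1/t ≤ log t` at `t = α c / (β c * r)`; the choice of `r` makes the corrections
  -- `α c - β c * r` sum to zero.
  have key : ∀ c, α c * Real.log r + (α c - β c * r) ≤ α c * Real.log (α c / β c) := by
    intro c
    rcases (hα c).eq_or_lt with ha | ha
    · rw [← ha]
      have := mul_nonneg (hβ c) hr0.le
      simp [this]
    · have hb : 0 < β c := (hβ c).lt_of_ne fun h => ha.ne' (h0 c h.symm)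
      have h1 := Real.one_sub_inv_le_log_of_pos (show 0 < α c / β c / r by positivity)
      rw [Real.log_div (by positivity) hr0.ne'] at h1
      have h2 := mul_le_mul_of_nonneg_left h1 ha.le
      have h3 : α c * (1 - (α c / β c / r)⁻¹) = α c - β c * r := by
        field_simp
      linarith
  have hsum := Finset.sum_le_sum fun c (_ : c ∈ Finset.univ) => key c
  rw [Finset.sum_add_distrib, Finset.sum_sub_distrib, ← Finset.sum_mul, ← Finset.sum_mul] at hsum
  have hBr : (∑ c, β c) * r = ∑ c, α c := by rw [hr]; field_simp
  rw [hBr, sub_self, add_zero] at hsum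
  simp only [Real.logb, ← mul_div_assoc, ← Finset.sum_div]
  gcongr

/-- Mutual information does not increase when the second variable is processed by a channel. -/
theorem mutualInfo_comp_le {A C Y : Type} [Fintype A] [Fintype C] [Fintype Y]
    (p : A → C → ℝ) (W : C → Y → ℝ) (hp : ∀ a c, 0 ≤ p a c) (hW : ∀ c y, 0 ≤ W c y)
    (hW1 : ∀ c, ∑ y, W c y = 1) :
    mutualInfo (fun a y => ∑ c, p a c * W c y) ≤ mutualInfo p := by
  unfold mutualInfo
  refine Finset.sum_le_sum fun a _ => ?_
  have hrow : ∑ y, ∑ c, p a c * W c y = ∑ c, p a c := by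
    rw [Finset.sum_comm]
    simp [← Finset.mul_sum, hW1]
  have hcol : ∀ y, ∑ a', ∑ c, p a' c * W c y = ∑ c, (∑ a', p a' c) * W c y := by
    intro y
    rw [Finset.sum_comm]
    simp [Finset.sum_mul]
  -- Log-sum inequality over `c` for each `y`; the common factor `W c y` then cancels inside the
  -- logarithm.
  calc _ ≤ ∑ y, ∑ c, p a c * W c y * Real.logb 2
          (p a c * W c y / ((∑ c', p a c') * ((∑ a', p a' c) * W c y))) := by
        refine Finset.sum_le_sum fun y _ => ?_
        rw [hrow, hcol, Finset.mul_sum]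
        refine logb_sum_inequality _ _ (fun c => mul_nonneg (hp _ _) (hW _ _)) (fun c => ?_) ?_
        · exact mul_nonneg (Finset.sum_nonneg fun _ _ => hp _ _)
            (mul_nonneg (Finset.sum_nonneg fun _ _ => hp _ _) (hW _ _))
        · intro c h
          rcases mul_eq_zero.1 h with h | h
          · rw [(Finset.sum_eq_zero_iff_of_nonneg fun c _ => hp a c).1 h c (Finset.mem_univ c),
              zero_mul]
          rcases mul_eq_zero.1 h with h | h
          · rw [(Finset.sum_eq_zero_iff_of_nonneg fun a _ => hp a c).1 h a (Finset.mem_univ a),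
              zero_mul]
          · rw [h, mul_zero]
    _ = ∑ y, ∑ c, p a c * Real.logb 2
          (p a c / ((∑ c', p a c') * ∑ a', p a' c)) * W c y := by
        refine Finset.sum_congr rfl fun y _ => Finset.sum_congr rfl fun c _ => ?_
        rcases eq_or_ne (W c y) 0 with h | h
        · simp [h]
        · rw [← mul_assoc, mul_div_mul_right _ _ h]
          ring
    _ = _ := by
        rw [Finset.sum_comm]
        simp [← Finset.mul_sum, hW1]

theorem mutualInfo_comp_equiv {A Y Z : Type} [Fintype A] [Fintype Y] [Fintype Z]
    (p : A → Y → ℝ) (e : Z ≃ Y) : mutualInfo (fun a z => p a (e z)) = mutualInfo p := by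
  unfold mutualInfo
  refine Finset.sum_congr rfl fun a _ => ?_
  rw [e.sum_comp (p a)]
  exact e.sum_comp fun y => p a y * Real.logb 2 (p a y / ((∑ y', p a y') * ∑ a', p a' y))

/-! ### States with a common eigenbasis -/

/-- The measurement in the orthonormal basis formed by the columns of `U`. -/
def basisPOVM {ι Y : Type} [Fintype ι] [DecidableEq ι] [Fintype Y] (U : Matrix ι ι ℂ)
    (hU : U * U.conjTranspose = 1) (e : Y ≃ ι) : POVM ι Y where
  effect y := U * Matrix.single (e y) (e y) 1 * U.conjTranspose
  posSemidef y := by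
    have h : (Matrix.single (e y) (e y) (1 : ℂ)).PosSemidef := by
      rw [← Matrix.diagonal_single]
      refine Matrix.PosSemidef.diagonal fun i => ?_
      by_cases h : i = e y
      · subst h; simp
      · simp [h]
    exact h.mul_mul_conjTranspose_same U
  sum_eq_one := by
    rw [← Finset.sum_mul, ← Finset.mul_sum, e.sum_comp fun i => Matrix.single i i (1 : ℂ),
      Matrix.sum_single_one, mul_one, hU]

/-- For a state diagonal in the columns of `U`, any effect acts as a classical test on the
eigenvalue index, with weights the diagonal of `Uᴴ E U`. -/
theorem trace_mul_effect_eq_sum {ι : Type} [Fintype ι] [DecidableEq ι] (U E : Matrix ι ι ℂ)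
    (d : ι → ℝ) :
    ((U * Matrix.diagonal (fun i => (d i : ℂ)) * U.conjTranspose * E).trace).re
      = ∑ i, d i * ((U.conjTranspose * E * U) i i).re := by
  have : U * Matrix.diagonal (fun i => (d i : ℂ)) * U.conjTranspose * E
      = U * (Matrix.diagonal (fun i => (d i : ℂ)) * (U.conjTranspose * E)) := by
    simp only [Matrix.mul_assoc]
  rw [this, Matrix.trace_mul_comm, Matrix.mul_assoc, Matrix.trace]
  simp [Matrix.diagonal_mul]

/-- If all states of Bob are diagonal in one orthonormal basis, the measurement in that basis is
optimal, and the learnable information is the classical one. -/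
theorem isLearnableInfo_of_common_basis {n k : ℕ} {A : Type} [Fintype A] [DecidableEq A]
    (f : Input n → A) (U : Matrix (BobSpace n k) (BobSpace n k) ℂ)
    (hU : U * U.conjTranspose = 1) (d : Input n → BobSpace n k → ℝ) (hd : ∀ x z, 0 ≤ d x z)
    (h : ∀ x, bobState n k x = U * Matrix.diagonal (fun z => (d x z : ℂ)) * U.conjTranspose) :
    IsLearnableInfo n k f (mutualInfo fun a z =>
      ∑ x : Input n, if f x = a then ((2 : ℝ) ^ n)⁻¹ * d x z else 0) := by
  have hU' : U.conjTranspose * U = 1 := mul_eq_one_comm.1 hU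
  constructor
  · let e := (Fintype.equivFin (BobSpace n k)).symm
    refine ⟨Fintype.card (BobSpace n k), basisPOVM U hU e, ?_⟩
    rw [← mutualInfo_comp_equiv _ e]
    congr 1
    funext a y
    unfold jointLaw
    refine Finset.sum_congr rfl fun x _ => ?_
    congr 2
    rw [h, trace_mul_effect_eq_sum]
    have : U.conjTranspose * (basisPOVM U hU e).effect y * U = Matrix.single (e y) (e y) 1 := by
      simp only [basisPOVM]
      rw [show U.conjTranspose * (U * Matrix.single (e y) (e y) 1 * U.conjTranspose) * U
        = (U.conjTranspose * U) * Matrix.single (e y) (e y) 1 * (U.conjTranspose * U) by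
          simp only [Matrix.mul_assoc], hU', one_mul, mul_one]
    rw [this, Finset.sum_eq_single (e y)]
    · simp
    · intro b _ hb
      simp [hb.symm]
    · simp
  · rintro r ⟨m, M, rfl⟩
    -- These diagonal entries form a classical channel from `z` to `y`, so every measurement
    -- post-processes the one in the basis `U`.
    have hpos : ∀ z y, 0 ≤ (U.conjTranspose * M.effect y * U) z z := fun z y =>
      ((M.posSemidef y).conjTranspose_mul_mul_same U).diag_nonneg
    have hlaw : jointLaw f M = fun a y => ∑ z,
        (∑ x : Input n, if f x = a then ((2 : ℝ) ^ n)⁻¹ * d x z else 0) *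
          ((U.conjTranspose * M.effect y * U) z z).re := by
      funext a y
      simp only [jointLaw, Finset.sum_mul]
      rw [Finset.sum_comm]
      refine Finset.sum_congr rfl fun x _ => ?_
      split_ifs
      · rw [h, trace_mul_effect_eq_sum, Finset.mul_sum]
        simp only [mul_assoc]
      · simp
    rw [hlaw]
    refine mutualInfo_comp_le _ _ (fun a z => ?_) (fun z y => ?_) fun z => ?_
    · refine Finset.sum_nonneg fun x _ => ?_
      have := hd x z
      split_ifs <;> positivity
    · exact (Complex.le_def.1 (hpos z y)).1
    · rw [← Complex.re_sum, ← Matrix.sum_apply, ← Finset.sum_mul, ← Finset.mul_sum, M.sum_eq_one,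
        mul_one, hU']
      simp

/-! ### The common eigenbasis -/

/-- The basis of the `l`-th qubit of a pair: computational for `l = 0`, Hadamard for `l = 1`. -/
def ketPair (l : Fin 2) (c : ZMod 2) : ZMod 2 → ℂ := if l = 0 then ketZ c else ketX c

/-- The correction bit that Bob gets for a qubit. -/
def knownBit {n k : ℕ} (m : Message n k) (p : QubitLabel n k) : ZMod 2 :=
  if p.2.2 = 0 then (m (p.1, p.2.1)).1 else (m (p.1, p.2.1)).2

/-- The joint law of the announced correction bit `m` and of the result `c` of measuring the
`l`-th qubit in the basis `ketPair l`, for the bit `x` encoded with basis bit `s`. -/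
def qubitLaw (x s : ZMod 2) (l : Fin 2) (m c : ZMod 2) : ℝ :=
  if (s = 0 ↔ l = 0) then (if c = x + m then 1 / 2 else 0) else 1 / 4

theorem zmod_two_cases (P : ZMod 2 → Prop) (h0 : P 0) (h1 : P 1) (a : ZMod 2) : P a := by
  fin_cases a
  · exact h0
  · exact h1

theorem sum_zmod_two {M : Type} [AddCommMonoid M] (f : ZMod 2 → M) : ∑ a, f a = f 0 + f 1 :=
  Fin.sum_univ_two f

theorem inv_sqrt_two_mul_self : ((Real.sqrt 2 : ℂ))⁻¹ * ((Real.sqrt 2 : ℂ))⁻¹ = 1 / 2 := by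
  rw [← mul_inv, ← Complex.ofReal_mul, Real.mul_self_sqrt (by norm_num)]
  norm_num

theorem ketPair_complete (l : Fin 2) (q q' : ZMod 2) :
    ∑ c, ketPair l c q * star (ketPair l c q') = if q = q' then 1 else 0 := by
  have h := inv_sqrt_two_mul_self
  rw [sum_zmod_two]
  fin_cases l <;> induction q using zmod_two_cases <;> induction q' using zmod_two_cases <;>
    simp [ketPair, ketZ, ketX, div_eq_mul_inv, h] <;> norm_num

theorem teleport_apply (ψ : ZMod 2 → ℂ) (a b z : ZMod 2) :
    teleport ψ (a, b) z = (if b = 1 ∧ z + a = 1 then -1 else 1) / 2 * ψ (z + a) := by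
  have h := inv_sqrt_two_mul_self
  have h2 : (1 + 1 : ZMod 2) = 0 := rfl
  simp only [teleport, bell, sum_zmod_two]
  induction a using zmod_two_cases <;> induction b using zmod_two_cases <;>
    induction z using zmod_two_cases <;>
    simp [div_eq_mul_inv, h2] <;> linear_combination (ψ _) * h

/-- The sum over the withheld correction bit removes the coherences in the basis `ketPair l`. The
announced bit is unbiased, and the result is either fixed by `x` and `m` (weight 1/2) or uniform
(weight 1/4). -/
theorem sum_teleport_encode (x s : ZMod 2) (l : Fin 2) (m q q' : ZMod 2) :
    (∑ o : ZMod 2 × ZMod 2, if (if l = 0 then o.1 else o.2) = m then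
        teleport (encode x s l) o q * star (teleport (encode x s l) o q') else 0)
      = ∑ c, (qubitLaw x s l m c : ℂ) * (ketPair l c q * star (ketPair l c q')) := by
  have h := inv_sqrt_two_mul_self
  have h2 : (1 + 1 : ZMod 2) = 0 := rfl
  rw [Fintype.sum_prod_type]
  simp only [sum_zmod_two, teleport_apply, encode, qubitLaw, ketPair]
  fin_cases l <;> induction m using zmod_two_cases <;> induction s using zmod_two_cases <;>
    induction x using zmod_two_cases <;>
    induction q using zmod_two_cases <;> induction q' using zmod_two_cases <;>
    simp [ketZ, ketX, div_eq_mul_inv, h2] <;> ring_nf <;> simp [pow_two, h] <;> norm_num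

theorem prod_sum_eq_sum_prod {P T R : Type} [Fintype P] [DecidableEq P] [Fintype T]
    [CommSemiring R] (f : P → T → R) : ∏ p, ∑ t, f p t = ∑ g : P → T, ∏ p, f p (g p) := by
  rw [Finset.prod_univ_sum, Fintype.piFinset_univ]

theorem message_eq_iff {n k : ℕ} (o : BellOutcomes n k) (m : Message n k) :
    message o = m ↔ ∀ p, (if p.2.2 = 0 then (o p).1 else (o p).2) = knownBit m p := by
  constructor
  · rintro rfl ⟨i, j, l⟩
    fin_cases l <;> simp [message, knownBit]
  · intro h
    funext ⟨i, j⟩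
    have h0 := h (i, j, 0)
    have h1 := h (i, j, 1)
    simp only [knownBit, if_true, one_ne_zero, if_false] at h0 h1
    exact Prod.ext h0 h1

/-- The orthonormal basis in which all states of Bob are diagonal. -/
def commonBasis (n k : ℕ) : Matrix (BobSpace n k) (BobSpace n k) ℂ := fun z z' =>
  if z.1 = z'.1 then ∏ p, ketPair p.2.2 (z'.2 p) (z.2 p) else 0

/-- The law of Alice's message and of the result of Bob's measurement in the common basis. -/
def bobLaw (n k : ℕ) (x : Input n) (z : BobSpace n k) : ℝ :=
  (((shares n k x).card : ℝ)⁻¹ * ((2 : ℝ) ^ k)⁻¹) *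
    ∑ w ∈ shares n k x, ∑ s : Fin k → ZMod 2,
      ∏ p : QubitLabel n k,
        qubitLaw (w p.1 p.2.1) (s p.2.1) p.2.2 (knownBit z.1 p) (z.2 p)

theorem commonBasis_mul_diagonal_apply (n k : ℕ) (d : BobSpace n k → ℂ) (z z' : BobSpace n k) :
    (commonBasis n k * Matrix.diagonal d * (commonBasis n k).conjTranspose) z z'
      = if z.1 = z'.1 then ∑ c : Qubits n k, d (z.1, c) *
          ∏ p, (ketPair p.2.2 (c p) (z.2 p) * star (ketPair p.2.2 (c p) (z'.2 p))) else 0 := by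
  obtain ⟨m, q⟩ := z
  obtain ⟨m', q'⟩ := z'
  rw [Matrix.mul_apply, Fintype.sum_prod_type]
  simp only [Matrix.mul_diagonal, Matrix.conjTranspose_apply, commonBasis]
  rw [Finset.sum_eq_single m]
  · rcases eq_or_ne m m' with h | h
    · simp only [h, if_true]
      refine Finset.sum_congr rfl fun c _ => ?_
      rw [Finset.prod_mul_distrib, star_prod]
      ring
    · simp [h, h.symm]
  · intro b _ hb
    simp [hb.symm]
  · simp

theorem commonBasis_mul_conjTranspose (n k : ℕ) :
    commonBasis n k * (commonBasis n k).conjTranspose = 1 := by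
  have h := fun z z' => commonBasis_mul_diagonal_apply n k (fun _ => 1) z z'
  rw [Matrix.diagonal_one, mul_one] at h
  ext z z'
  rw [h]
  simp only [one_mul]
  rw [← prod_sum_eq_sum_prod fun (p : QubitLabel n k) c =>
    ketPair p.2.2 c (z.2 p) * star (ketPair p.2.2 c (z'.2 p))]
  simp only [ketPair_complete, Finset.prod_ite_zero, Finset.prod_const_one, Matrix.one_apply,
    Prod.ext_iff, funext_iff, Finset.mem_univ, true_implies, ite_and]

/-- For fixed `w` and `s` both sides factor over the qubits, since fixing the message is one
condition per qubit; this reduces to `sum_teleport_encode`. -/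
theorem sum_bobVector {n k : ℕ} (w : Fin n → Fin k → ZMod 2) (s : Fin k → ZMod 2)
    (m : Message n k) (q q' : Qubits n k) :
    (∑ o : BellOutcomes n k, if message o = m then
        bobVector w s o q * star (bobVector w s o q') else 0)
      = ∑ c : Qubits n k,
          (∏ p, (qubitLaw (w p.1 p.2.1) (s p.2.1) p.2.2 (knownBit m p) (c p) : ℂ)) *
          ∏ p, (ketPair p.2.2 (c p) (q p) * star (ketPair p.2.2 (c p) (q' p))) := by
  simp only [← Finset.prod_mul_distrib]
  rw [← prod_sum_eq_sum_prod fun (p : QubitLabel n k) c =>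
    (qubitLaw (w p.1 p.2.1) (s p.2.1) p.2.2 (knownBit m p) c : ℂ) *
      (ketPair p.2.2 c (q p) * star (ketPair p.2.2 c (q' p)))]
  simp only [← sum_teleport_encode]
  rw [prod_sum_eq_sum_prod]
  refine Finset.sum_congr rfl fun o _ => ?_
  rw [Finset.prod_ite_zero]
  simp only [message_eq_iff, Finset.mem_univ, true_implies, bobVector, star_prod,
    Finset.prod_mul_distrib]

theorem bobState_eq (n k : ℕ) (x : Input n) :
    bobState n k x = commonBasis n k * Matrix.diagonal (fun z => (bobLaw n k x z : ℂ)) *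
      (commonBasis n k).conjTranspose := by
  ext ⟨m, q⟩ ⟨m', q'⟩
  rw [commonBasis_mul_diagonal_apply]
  simp only [bobState, Matrix.smul_apply, Matrix.sum_apply, Matrix.kroneckerMap_apply,
    Matrix.vecMulVec_apply, Pi.star_apply, smul_eq_mul, Matrix.single_apply]
  rcases eq_or_ne m m' with rfl | h
  · simp only [and_self, ite_mul, one_mul, zero_mul, sum_bobVector, if_true, bobLaw]
    push_cast
    simp only [Finset.mul_sum, Finset.sum_mul]
    conv_rhs => rw [Finset.sum_comm]
    refine Finset.sum_congr rfl fun w _ => ?_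
    conv_rhs => rw [Finset.sum_comm]
    refine Finset.sum_congr rfl fun t _ => Finset.sum_congr rfl fun c _ => ?_
    simp only [mul_assoc]
  · rw [if_neg h]
    have : ∀ o : BellOutcomes n k, ¬ (message o = m ∧ message o = m') :=
      fun o ho => h (ho.1.symm.trans ho.2)
    simp [this]

/-! ### The law of Bob's observations -/

/-- All fibres of a surjective homomorphism have equal size; every uniformity claim below comes from
this. -/
theorem card_fiber_mul_card {G H : Type} [AddGroup G] [AddGroup H] [Fintype G] [Fintype H]
    [DecidableEq H] (φ : G →+ H) (hφ : Function.Surjective φ) (h : H) :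
    (Finset.univ.filter fun g => φ g = h).card * Fintype.card H = Fintype.card G := by
  have hc : ∀ h' ∈ (Finset.univ : Finset H),
      (Finset.univ.filter fun g => φ g = h').card = (Finset.univ.filter fun g => φ g = h).card :=
    fun h' _ => AddMonoidHom.card_fiber_eq_of_mem_range φ (hφ h') (hφ h)
  rw [← Finset.card_univ (α := G),
    Finset.card_eq_sum_card_fiberwise (s := Finset.univ) (f := φ) (t := Finset.univ) (by simp),
    Finset.sum_congr rfl hc, Finset.sum_const, Finset.card_univ, smul_eq_mul, mul_comm]

/-- The corrected result of the measurement on the first qubit of a pair. -/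
def firstBit {n k : ℕ} (z : BobSpace n k) (i : Fin n) (j : Fin k) : ZMod 2 :=
  z.2 (i, j, 0) + (z.1 (i, j)).1

/-- The sum of the corrected results of the measurements on the two qubits of a pair. -/
def bitDiff {n k : ℕ} (z : BobSpace n k) (i : Fin n) (j : Fin k) : ZMod 2 :=
  firstBit z i j + (z.2 (i, j, 1) + (z.1 (i, j)).2)

/-- Alice's input, reconstructed from Bob's observations and from the basis bits. -/
def inputGuess {n k : ℕ} (s : Fin k → ZMod 2) : BobSpace n k →+ Input n where
  toFun z i := ∑ j, (firstBit z i j + s j * bitDiff z i j)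
  map_zero' := by
    funext i
    simp [firstBit, bitDiff]
  map_add' z z' := by
    funext i
    simp only [firstBit, bitDiff, Pi.add_apply, Prod.fst_add, Prod.snd_add,
      ← Finset.sum_add_distrib]
    exact Finset.sum_congr rfl fun j _ => by ring

theorem inputGuess_apply {n k : ℕ} (s : Fin k → ZMod 2) (z : BobSpace n k) (i : Fin n) :
    inputGuess s z i = ∑ j, firstBit z i j + ∑ j, s j * bitDiff z i j := by
  rw [← Finset.sum_add_distrib]
  rfl

theorem inputGuess_surjective {n k : ℕ} (hk : 0 < k) (s : Fin k → ZMod 2) :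
    Function.Surjective (inputGuess s : BobSpace n k →+ Input n) := by
  intro x
  -- Both qubits of each pair agree, so `bitDiff` vanishes and `s` has no influence; the first share
  -- carries all of `x i`.
  refine ⟨(0, fun p => if p.2.1 = ⟨0, hk⟩ then x p.1 else 0), ?_⟩
  funext i
  rw [inputGuess_apply]
  simp [firstBit, bitDiff, CharTwo.add_self_eq_zero]

theorem card_shares_mul (n k : ℕ) (hk : 0 < k) (x : Input n) :
    (shares n k x).card * 2 ^ n = 2 ^ (n * k) := by
  let φ : (Fin n → Fin k → ZMod 2) →+ Input n :=
    { toFun := fun w i => ∑ j, w i j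
      map_zero' := by funext i; simp
      map_add' := fun w w' => by funext i; simp [Finset.sum_add_distrib] }
  have hφ : Function.Surjective φ := fun x =>
    ⟨fun i j => if j = ⟨0, hk⟩ then x i else 0, by funext i; simp [φ]⟩
  have h := card_fiber_mul_card φ hφ x
  simp only [Fintype.card_fun, ZMod.card, Fintype.card_fin, ← pow_mul, mul_comm k n] at h
  rw [← h]
  congr 2
  ext w
  simp [shares, φ, funext_iff]

theorem card_bobSpace (n k : ℕ) : Fintype.card (BobSpace n k) = 16 ^ (n * k) := by
  simp only [Fintype.card_prod, Fintype.card_fun, ZMod.card, Fintype.card_fin]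
  rw [← mul_assoc, mul_comm (n * k) 2, pow_mul 2 2, ← mul_pow]
  norm_num

/-- In each pair one qubit determines the share (weight 1/2) and the other is noise (weight 1/4),
whence 1/8 per pair. -/
theorem prod_qubitLaw {n k : ℕ} (w : Fin n → Fin k → ZMod 2) (s : Fin k → ZMod 2)
    (z : BobSpace n k) :
    ∏ p : QubitLabel n k, qubitLaw (w p.1 p.2.1) (s p.2.1) p.2.2 (knownBit z.1 p) (z.2 p)
      = if w = fun i j => firstBit z i j + s j * bitDiff z i j
        then (1 / 8 : ℝ) ^ (n * k) else 0 := by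
  have key : ∀ x t a b c d : ZMod 2, qubitLaw x t 0 a c * qubitLaw x t 1 b d
      = if x = (c + a) + t * ((c + a) + (d + b)) then 1 / 8 else 0 := by
    intro x t a b c d
    have e1 : (c = x + a) ↔ x = c + a := by
      constructor <;> rintro rfl <;> simp [add_assoc, CharTwo.add_self_eq_zero]
    have e2 : (d = x + b) ↔ x = d + b := by
      constructor <;> rintro rfl <;> simp [add_assoc, CharTwo.add_self_eq_zero]
    induction t using zmod_two_cases
    · have h1 : qubitLaw x 0 0 a c = if x = c + a then 1 / 2 else 0 := by
        rw [← if_congr e1 rfl rfl]; simp [qubitLaw]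
      have h2 : qubitLaw x 0 1 b d = 1 / 4 := by simp [qubitLaw]
      rw [h1, h2, zero_mul, add_zero]
      split_ifs <;> norm_num
    · have h1 : qubitLaw x 1 0 a c = 1 / 4 := by simp [qubitLaw]
      have h2 : qubitLaw x 1 1 b d = if x = d + b then 1 / 2 else 0 := by
        rw [← if_congr e2 rfl rfl]; simp [qubitLaw]
      rw [h1, h2, one_mul, ← add_assoc (c + a), CharTwo.add_self_eq_zero, zero_add]
      split_ifs <;> norm_num
  simp only [Fintype.prod_prod_type, Fin.prod_univ_two, knownBit, if_true, one_ne_zero, if_false,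
    key, Finset.prod_ite_zero, funext_iff, Finset.mem_univ, true_implies, Finset.prod_const,
    Finset.card_univ, Fintype.card_fin, ← pow_mul, mul_comm k n, firstBit, bitDiff]

/-- Given `z`, each `s` is compatible with exactly one family of shares, hence with one input; the
weights `2 ^ (-n * k)` and `8 ^ (-n * k)` combine to the uniform law on `BobSpace n k`. -/
theorem bobLaw_eq {n k : ℕ} (hk : 0 < k) (x : Input n) (z : BobSpace n k) :
    ((2 : ℝ) ^ n)⁻¹ * bobLaw n k x z
      = ((Fintype.card (BobSpace n k) : ℝ)⁻¹ * ((2 : ℝ) ^ k)⁻¹) *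
        ∑ s : Fin k → ZMod 2, if inputGuess s z = x then 1 else 0 := by
  have hc : ((shares n k x).card : ℝ) * 2 ^ n = 2 ^ (n * k) := by
    exact_mod_cast card_shares_mul n k hk x
  have hmem : ∀ s : Fin k → ZMod 2,
      (fun i j => firstBit z i j + s j * bitDiff z i j) ∈ shares n k x ↔ inputGuess s z = x := by
    intro s
    simp [shares, funext_iff, inputGuess]
  have hsum : ∑ w ∈ shares n k x, ∑ s : Fin k → ZMod 2, ∏ p : QubitLabel n k,
        qubitLaw (w p.1 p.2.1) (s p.2.1) p.2.2 (knownBit z.1 p) (z.2 p)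
      = (1 / 8 : ℝ) ^ (n * k) * ∑ s : Fin k → ZMod 2, if inputGuess s z = x then 1 else 0 := by
    rw [Finset.sum_comm, Finset.mul_sum]
    refine Finset.sum_congr rfl fun s _ => ?_
    simp only [prod_qubitLaw, Finset.sum_ite_eq', hmem]
    simp
  have hconst : ((2 : ℝ) ^ n)⁻¹ * (((shares n k x).card : ℝ)⁻¹ * (1 / 8 : ℝ) ^ (n * k))
      = (Fintype.card (BobSpace n k) : ℝ)⁻¹ := by
    rw [← mul_assoc, ← mul_inv, mul_comm _ ((shares n k x).card : ℝ), hc, card_bobSpace,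
      one_div, inv_pow, ← mul_inv, ← mul_pow]
    norm_num
  rw [bobLaw, hsum, ← hconst]
  ring

theorem bobLaw_nonneg (n k : ℕ) (x : Input n) (z : BobSpace n k) : 0 ≤ bobLaw n k x z := by
  unfold bobLaw qubitLaw
  refine mul_nonneg (by positivity) (Finset.sum_nonneg fun w _ => Finset.sum_nonneg fun s _ =>
    Finset.prod_nonneg fun p _ => ?_)
  split_ifs <;> norm_num

/-- The joint law of `F` of Alice's input and of Bob's observations in the common basis. -/
def observedLaw {n k : ℕ} {A : Type} [DecidableEq A] (F : Input n → A) (a : A)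
    (z : BobSpace n k) : ℝ :=
  ((Fintype.card (BobSpace n k) : ℝ)⁻¹ * ((2 : ℝ) ^ k)⁻¹) *
    (Finset.univ.filter fun s : Fin k → ZMod 2 => F (inputGuess s z) = a).card

theorem isLearnableInfo_observedLaw {n k : ℕ} (hk : 0 < k) {A : Type} [Fintype A] [DecidableEq A]
    (F : Input n → A) :
    IsLearnableInfo n k F (mutualInfo (observedLaw (k := k) F)) := by
  convert isLearnableInfo_of_common_basis F (commonBasis n k) (commonBasis_mul_conjTranspose n k)
    (bobLaw n k) (bobLaw_nonneg n k) (bobState_eq n k) using 2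
  funext a z
  simp only [bobLaw_eq hk, observedLaw, Finset.card_filter]
  push_cast
  rw [← Finset.sum_filter (s := Finset.univ) (p := fun x => F x = a), ← Finset.mul_sum,
    Finset.sum_comm]
  congr 1
  refine Finset.sum_congr rfl fun s _ => ?_
  simp [Finset.sum_ite_eq]

theorem sum_observedLaw_fst {n k : ℕ} {A : Type} [Fintype A] [DecidableEq A] (F : Input n → A)
    (z : BobSpace n k) : ∑ a, observedLaw F a z = (Fintype.card (BobSpace n k) : ℝ)⁻¹ := by
  simp only [observedLaw, ← Finset.mul_sum]
  rw [← Nat.cast_sum, ← Finset.card_eq_sum_card_fiberwise (by simp)]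
  simp [mul_assoc]

/-- For each fixed `s`, `F ∘ inputGuess s` is a surjective homomorphism, so it maps uniform `z` to a
uniform value. -/
theorem sum_observedLaw_snd {n k : ℕ} (hk : 0 < k) {A : Type} [AddGroup A] [Fintype A]
    [DecidableEq A] (F : Input n →+ A) (hF : Function.Surjective F) (a : A) :
    ∑ z : BobSpace n k, observedLaw F a z = (Fintype.card A : ℝ)⁻¹ := by
  have h : ∀ s : Fin k → ZMod 2,
      (∑ z : BobSpace n k, if F (inputGuess s z) = a then (1 : ℝ) else 0)
        = Fintype.card (BobSpace n k) * (Fintype.card A : ℝ)⁻¹ := by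
    intro s
    have h := card_fiber_mul_card (F.comp (inputGuess (n := n) s))
      (hF.comp (inputGuess_surjective hk s)) a
    have hA : (Fintype.card A : ℝ) ≠ 0 := by exact_mod_cast Fintype.card_ne_zero
    rw [Finset.sum_boole, ← h, Nat.cast_mul, mul_assoc, mul_inv_cancel₀ hA, mul_one]
    rfl
  have hB : (Fintype.card (BobSpace n k) : ℝ) ≠ 0 := by exact_mod_cast Fintype.card_ne_zero
  simp only [observedLaw, ← Finset.mul_sum, Finset.card_filter]
  push_cast
  rw [Finset.sum_comm, Finset.sum_congr rfl fun s _ => h s]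
  simp only [Finset.sum_const, Finset.card_univ, Fintype.card_fun, ZMod.card, Fintype.card_fin,
    nsmul_eq_mul]
  push_cast
  field_simp

/-! ### Evaluation of the mutual information -/

/-- The hom that maps Bob's observations to the sums of the two bits of each pair `(i, j)`. -/
def bitDiffHom {n k : ℕ} (i : Fin n) : BobSpace n k →+ (Fin k → ZMod 2) where
  toFun z j := bitDiff z i j
  map_zero' := by
    funext j
    simp [firstBit, bitDiff]
  map_add' z z' := by
    funext j
    simp only [firstBit, bitDiff, Pi.add_apply, Prod.fst_add, Prod.snd_add]
    ring

theorem bitDiffHom_surjective {n k : ℕ} (i : Fin n) :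
    Function.Surjective (bitDiffHom i : BobSpace n k →+ _) := by
  intro d
  refine ⟨(0, fun p => if p.2.2 = 0 then d p.2.1 else 0), ?_⟩
  funext j
  simp [bitDiffHom, firstBit, bitDiff]

/-- `s ↦ ∑ j, s j * bitDiff z i j` is a nonzero linear functional, so it takes each value for half
of the `s`. -/
theorem observedLaw_bit_of_bitDiff_ne_zero {n k : ℕ} (i : Fin n) (a : ZMod 2) (z : BobSpace n k)
    (hz : bitDiffHom i z ≠ 0) :
    observedLaw (fun x : Input n => x i) a z = (Fintype.card (BobSpace n k) : ℝ)⁻¹ * 2⁻¹ := by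
  let φ : (Fin k → ZMod 2) →+ ZMod 2 :=
    { toFun := fun s => ∑ j, s j * bitDiff z i j
      map_zero' := by simp
      map_add' := fun s t => by simp [add_mul, Finset.sum_add_distrib] }
  have hφ : Function.Surjective φ := by
    obtain ⟨j, hj⟩ := Function.ne_iff.1 hz
    have hj' : bitDiff z i j ≠ 0 := hj
    exact fun b => ⟨Pi.single j (b * (bitDiff z i j)⁻¹), by
      simp [φ, Pi.single_apply, mul_assoc, inv_mul_cancel₀ hj']⟩
  have h := card_fiber_mul_card φ hφ (a - ∑ j, firstBit z i j)
  simp only [Fintype.card_fun, ZMod.card, Fintype.card_fin] at h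
  have h' : (Finset.univ.filter fun s : Fin k → ZMod 2 => inputGuess s z i = a)
      = Finset.univ.filter fun s => φ s = a - ∑ j, firstBit z i j := by
    ext s
    simp only [Finset.mem_filter, Finset.mem_univ, true_and, inputGuess_apply, eq_sub_iff_add_eq']
    rfl
  have hR : ((Finset.univ.filter fun s => φ s = a - ∑ j, firstBit z i j).card : ℝ) * 2 = 2 ^ k := by
    exact_mod_cast h
  simp only [observedLaw, h']
  rw [mul_assoc]
  congr 1
  rw [← hR]
  have : ((Finset.univ.filter fun s => φ s = a - ∑ j, firstBit z i j).card : ℝ) ≠ 0 := fun h0 => by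
    rw [h0, zero_mul] at hR
    exact absurd hR.symm (by positivity)
  field_simp

theorem observedLaw_bit_of_bitDiff_eq_zero {n k : ℕ} (i : Fin n) (a : ZMod 2) (z : BobSpace n k)
    (hz : bitDiffHom i z = 0) :
    observedLaw (fun x : Input n => x i) a z
      = if ∑ j, firstBit z i j = a then (Fintype.card (BobSpace n k) : ℝ)⁻¹ else 0 := by
  have hz' : ∀ j, bitDiff z i j = 0 := fun j => congrFun hz j
  simp only [observedLaw, inputGuess_apply, hz', mul_zero, Finset.sum_const_zero, add_zero]
  split_ifs with h <;> simp [h, mul_assoc]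

theorem mutualInfo_observedLaw_bit {n k : ℕ} (hk : 0 < k) (i : Fin n) :
    mutualInfo (observedLaw (k := k) fun x : Input n => x i) = 1 / 2 ^ k := by
  have hB : (Fintype.card (BobSpace n k) : ℝ) ≠ 0 := by exact_mod_cast Fintype.card_ne_zero
  have hrow : ∀ a, ∑ z : BobSpace n k, observedLaw (fun x : Input n => x i) a z = 2⁻¹ := by
    intro a
    have := sum_observedLaw_snd (k := k) hk (Pi.evalAddMonoidHom (fun _ : Fin n => ZMod 2) i)
      (Function.surjective_eval i) a
    rw [ZMod.card] at this
    exact_mod_cast this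
  have hterm : ∀ z : BobSpace n k, (∑ a, observedLaw (fun x : Input n => x i) a z *
        Real.logb 2 (observedLaw (fun x : Input n => x i) a z /
          (2⁻¹ * (Fintype.card (BobSpace n k) : ℝ)⁻¹)))
      = (Fintype.card (BobSpace n k) : ℝ)⁻¹ * if bitDiffHom i z = 0 then 1 else 0 := by
    intro z
    split_ifs with hz
    · simp only [observedLaw_bit_of_bitDiff_eq_zero i _ z hz]
      rw [Finset.sum_eq_single (∑ j, firstBit z i j)]
      · have : (Fintype.card (BobSpace n k) : ℝ)⁻¹ / (2⁻¹ * (Fintype.card (BobSpace n k) : ℝ)⁻¹)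
            = 2 := by field_simp
        rw [if_pos rfl, this, Real.logb_self_eq_one one_lt_two]
      · intro b _ hb
        simp [hb.symm]
      · simp
    · simp only [observedLaw_bit_of_bitDiff_ne_zero i _ z hz]
      rw [mul_comm (2⁻¹ : ℝ), div_self (by positivity)]
      simp
  -- The vector of differences is uniform on `2 ^ k` values, so it vanishes on a fraction `1 / 2 ^
  -- k` of the observations.
  have hcount := card_fiber_mul_card (bitDiffHom (k := k) i) (bitDiffHom_surjective i) 0
  simp only [Fintype.card_fun (α := Fin k), ZMod.card, Fintype.card_fin] at hcount
  unfold mutualInfo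
  simp only [hrow, sum_observedLaw_fst]
  rw [Finset.sum_comm, Finset.sum_congr rfl fun z _ => hterm z, ← Finset.mul_sum,
    Finset.sum_boole, ← hcount]
  have : ((Finset.univ.filter fun z : BobSpace n k => bitDiffHom i z = 0).card : ℝ) ≠ 0 := by
    intro h0
    rw [← hcount, Nat.cast_mul, h0, zero_mul] at hB
    exact hB rfl
  push_cast
  field_simp

theorem sub_le_mutualInfo_observedLaw_id {n k : ℕ} (hk : 0 < k) :
    (n : ℝ) - k ≤ mutualInfo (observedLaw (k := k) fun x : Input n => x) := by
  have hB : (0 : ℝ) < Fintype.card (BobSpace n k) := by exact_mod_cast Fintype.card_pos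
  have hrow : ∀ a, ∑ z : BobSpace n k, observedLaw (fun x : Input n => x) a z
      = ((2 : ℝ) ^ n)⁻¹ := by
    intro a
    have := sum_observedLaw_snd (k := k) hk (AddMonoidHom.id (Input n)) Function.surjective_id a
    rw [Fintype.card_fun, ZMod.card, Fintype.card_fin] at this
    push_cast at this
    exact this
  have htotal : ∑ a, ∑ z : BobSpace n k, observedLaw (fun x : Input n => x) a z = 1 := by
    rw [Finset.sum_comm]
    simp [sum_observedLaw_fst, -Fintype.card_prod]
  unfold mutualInfo
  simp only [hrow, sum_observedLaw_fst]
  -- As the joint law has total mass 1, it suffices that each logarithm of positive weight is at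
  -- least `n - k`: one compatible `s` already gives joint probability at least `2 ^ (-k)` times
  -- that of `z`, against `2 ^ (-n)` times it for the product of the marginals.
  rw [← one_mul ((n : ℝ) - k), ← htotal, Finset.sum_mul]
  refine Finset.sum_le_sum fun a _ => ?_
  rw [Finset.sum_mul]
  refine Finset.sum_le_sum fun z _ => ?_
  unfold observedLaw
  rcases Nat.eq_zero_or_pos
    (Finset.univ.filter fun s : Fin k → ZMod 2 => inputGuess s z = a).card with h0 | h0
  · simp [h0]
  · refine mul_le_mul_of_nonneg_left ?_ (by positivity)
    have h1 : (1 : ℝ) ≤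
        (Finset.univ.filter fun s : Fin k → ZMod 2 => inputGuess s z = a).card := by
      exact_mod_cast h0
    rw [Real.le_logb_iff_rpow_le one_lt_two (by positivity), Real.rpow_sub two_pos,
      Real.rpow_natCast, Real.rpow_natCast, le_div_iff₀ (by positivity)]
    calc (2 : ℝ) ^ n / 2 ^ k * (((2 : ℝ) ^ n)⁻¹ * (Fintype.card (BobSpace n k) : ℝ)⁻¹)
        = (Fintype.card (BobSpace n k) : ℝ)⁻¹ * ((2 : ℝ) ^ k)⁻¹ * 1 := by field_simp
      _ ≤ _ := by gcongr

end

end QHE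

theorem theorem5 (n k : ℕ) (hk : 0 < k) :
    (∀ i : Fin n, QHE.IsLearnableInfo n k (fun x => x i) (1 / 2 ^ k)) ∧
    ∃ r : ℝ, QHE.IsLearnableInfo n k (fun x => x) r ∧ (n : ℝ) - (k : ℝ) ≤ r := by
  refine ⟨fun i => ?_, _, QHE.isLearnableInfo_observedLaw hk _,
    QHE.sub_le_mutualInfo_observedLaw_id hk⟩
  rw [← QHE.mutualInfo_observedLaw_bit hk i]
  exact QHE.isLearnableInfo_observedLaw hk _
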